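/- Let $n\ge 1$ and let $\Phi:\mathbb R^n\to\mathbb R$ be a smooth ($C^\infty$) convex function satisfying the Kähler–Einstein equation $e^{-\Phi}=\det D^2\Phi$ on $\mathbb R^n$ (for instance, the solution with $\nabla\Phi(\mathbb R^n)=\operatorname{int}K$ associated with a convex body $K\subset\mathbb R^n$ whose barycenter is at the origin). Equip $\mathbb R^n$ with the Riemannian metric $h=\sum_{i,j}\Phi_{ij}\,dx^i dx^j$, where $\Phi_{ij}=\partial^2_{x_ix_j}\Phi$, and for a $C^2$ function $u$ put $$Lu=\sum_{i,j=1}^n\Phi^{ij}\,\partial^2_{x_ix_j}u,\qquad (\Phi^{ij})=(\Phi_{ij})^{-1}.$$ For $e\in\mathbb R^n$ write $\Phi_{ee}(x)=D^2\Phi(x)[e,e]$ and $\Phi_{eee}(x)=D^3\Phi(x)[e,e,e]$. Then for every $x\in\mathbb R^n$ the maximum $$f(x)=\max\{\Phi_{eee}(x)\,:\,e\in\mathbb R^n,\ \Phi_{ee}(x)=1\}$$ of $\Phi_{eee}(x)$ over the Riemannian unit vectors at $x$ is attained, and $f$ satisfies $$Lf\ \ge\ \tfrac12 f+\tfrac14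 f^3\quad\text{on }\mathbb R^n$$ in the barrier sense, that is: $f$ is continuous, and for every $x_0\in\mathbb R^n$ there are an open neighbourhood $U$ of $x_0$ and a $C^\infty$ function $\varphi$ on $U$ with $\varphi\le f$ on $U$, $\varphi(x_0)=f(x_0)$ and $$(L\varphi)(x_0)\ \ge\ \tfrac12 f(x_0)+\tfrac14 f(x_0)^3 .$$ -/

import Mathlib

open scoped ContDiff

noncomputable section

namespace KahlerEinstein

/-- The Euclidean Hessian matrix `(∂²u/∂xᵢ∂xⱼ)(x)`. -/
def hessianMatrix {n : ℕ} (u : EuclideanSpace ℝ (Fin n) → ℝ)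
    (x : EuclideanSpace ℝ (Fin n)) : Matrix (Fin n) (Fin n) ℝ :=
  Matrix.of fun i j =>
    iteratedFDeriv ℝ 2 u x ![EuclideanSpace.single i 1, EuclideanSpace.single j 1]

/-- `Φ` is a smooth convex solution on `ℝⁿ` of the Kähler–Einstein equation
`e^{-Φ} = det D²Φ`. -/
structure IsPotential {n : ℕ} (Φ : EuclideanSpace ℝ (Fin n) → ℝ) : Prop where
  contDiff : ContDiff ℝ ∞ Φ
  convexOn : ConvexOn ℝ Set.univ Φ
  equation : ∀ x, Real.exp (-Φ x) = (hessianMatrix Φ x).det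

/-- The weighted Laplacian `(L u)(x) = Φ^{ij}(x) u_{ij}(x)`, where `(Φ^{ij})` is the inverse
of the Hessian matrix of `Φ`. -/
def weightedLaplacian {n : ℕ} (Φ u : EuclideanSpace ℝ (Fin n) → ℝ)
    (x : EuclideanSpace ℝ (Fin n)) : ℝ :=
  ∑ i, ∑ j, (hessianMatrix Φ x)⁻¹ i j * hessianMatrix u x i j

/-- The tangent vectors at `x` of length one for the Hessian metric `h = D²Φ`. -/
def unitVectors {n : ℕ} (Φ : EuclideanSpace ℝ (Fin n) → ℝ)
    (x : EuclideanSpace ℝ (Fin n)) : Set (EuclideanSpace ℝ (Fin n)) :=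
  {e | iteratedFDeriv ℝ 2 Φ x ![e, e] = 1}

/-- The values `Φ_{eee}(x)`, where `e` runs over the Riemannian unit vectors at `x`. -/
def thirdDerivValues {n : ℕ} (Φ : EuclideanSpace ℝ (Fin n) → ℝ)
    (x : EuclideanSpace ℝ (Fin n)) : Set ℝ :=
  (fun e => iteratedFDeriv ℝ 3 Φ x ![e, e, e]) '' unitVectors Φ x

/-- `f(x) = max_{|e| = 1} Φ_{eee}(x)`. -/
def maxThirdDeriv {n : ℕ} (Φ : EuclideanSpace ℝ (Fin n) → ℝ)
    (x : EuclideanSpace ℝ (Fin n)) : ℝ :=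
  sSup (thirdDerivValues Φ x)

/-- `L f ≥ F` on `ℝⁿ` in the barrier sense: `f` is continuous, and at every point `x₀` some
function `φ` that is smooth near `x₀` touches `f` from below at `x₀` and satisfies
`(L φ)(x₀) ≥ F(x₀)`. -/
def LaplacianGeInBarrierSense {n : ℕ} (Φ f F : EuclideanSpace ℝ (Fin n) → ℝ) : Prop :=
  Continuous f ∧
    ∀ x₀, ∃ U : Set (EuclideanSpace ℝ (Fin n)), IsOpen U ∧ x₀ ∈ U ∧
      ∃ φ : EuclideanSpace ℝ (Fin n) → ℝ, ContDiffOn ℝ ∞ φ U ∧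
        (∀ x ∈ U, φ x ≤ f x) ∧ φ x₀ = f x₀ ∧ F x₀ ≤ weightedLaplacian Φ φ x₀

end KahlerEinstein

end

/-! Fix `x₀`, a maximizer `e` of `Φ_{eee}(x₀)` and the `D²Φ(x₀)`-self-adjoint endomorphism `A`
with `D²Φ(Av, w) = D³Φ(e, v, w)` at `x₀`. Extend `e` to the affine field `ε` with derivative
`-A/2`, which is parallel at `x₀`, so that `D²Φ(ε, ε) = 1` to first order there. Since
`q ↦ q^{-3/2}` is convex, replacing it by its tangent `(5 - 3 q) / 2` at `q = 1` turns
`D³Φ(ε, ε, ε) D²Φ(ε, ε)^{-3/2}` into a smooth `φ` that touches `f` from below at `x₀`. The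
derivatives of `Φ` of order four and five in `Lφ` are eliminated by differentiating
`log det D²Φ = -Φ` two and three times along `e`; in a `D²Φ`-orthonormal basis
`(eₖ)` containing `e`, `Lφ(x₀) = f / 2 + ∑ₖ (3/4 f |Aeₖ|² - 1/2 D³Φ(e, Aeₖ, Aeₖ))`.
Maximality of `e` gives `Ae = f e` at first order and `D³Φ(e, v, v) ≤ f |v|² / 2` for `v ⟂ e` at
second order. Hence the term of `e` is `f³ / 4` and, as `A` preserves the orthogonal complement of
`e`, the other terms are nonnegative. -/

namespace KahlerEinstein

section LogDet

variable {ι : Type*} [Fintype ι] {g h : ℝ → Matrix ι ι ℝ} {g' h' : Matrix ι ι ℝ} {t : ℝ}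

theorem hasDerivAt_matrix_trace (hg : HasDerivAt g g' t) :
    HasDerivAt (fun s => (g s).trace) g'.trace t :=
  HasDerivAt.fun_sum fun i _ => hasDerivAt_pi.1 (hasDerivAt_pi.1 hg i) i

theorem hasDerivAt_matrix_mul (hg : HasDerivAt g g' t) (hh : HasDerivAt h h' t) :
    HasDerivAt (fun s => g s * h s) (g' * h t + g t * h') t := by
  classical
  open scoped Matrix.Norms.Operator in exact hg.fun_mul hh

variable [DecidableEq ι]

theorem trace_adjugate_mul {R : Type*} [CommRing R] (A B : Matrix ι ι R) :
    (A.adjugate * B).trace = ∑ i, (A.updateCol i (B.col i)).det := by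
  simp only [Matrix.trace, Matrix.diag_apply, ← Matrix.cramer_apply,
    Matrix.cramer_eq_adjugate_mulVec]
  rfl

theorem hasDerivAt_matrix_det (hg : HasDerivAt g g' t) :
    HasDerivAt (fun s => (g s).det) ((g t).adjugate * g').trace t := by
  have hentry (i j : ι) : HasDerivAt (fun s => g s i j) (g' i j) t :=
    hasDerivAt_pi.1 (hasDerivAt_pi.1 hg i) j
  have hprod (σ : Equiv.Perm ι) : HasDerivAt (fun s => ∏ i, g s (σ i) i)
      (∑ i, ∏ j, (g t).updateCol i (g'.col i) (σ j) j) t := by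
    refine (HasDerivAt.fun_finsetProd (u := Finset.univ) fun i _ => hentry (σ i) i).congr_deriv
      (Finset.sum_congr rfl fun i _ => ?_)
    rw [← Finset.mul_prod_erase _ _ (Finset.mem_univ i), smul_eq_mul, mul_comm,
      Matrix.updateCol_self, Matrix.col_apply]
    exact congrArg _ (Finset.prod_congr rfl fun j hj =>
      (Matrix.updateCol_ne (Finset.ne_of_mem_erase hj)).symm)
  simp only [trace_adjugate_mul, Matrix.det_apply]
  rw [Finset.sum_comm]
  simp only [← Finset.smul_sum]
  exact HasDerivAt.fun_sum fun σ _ => (hprod σ).fun_const_smul _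

theorem hasDerivAt_log_det (hg : HasDerivAt g g' t) (hdet : (g t).det ≠ 0) :
    HasDerivAt (fun s => Real.log (g s).det) ((g t)⁻¹ * g').trace t := by
  refine ((hasDerivAt_matrix_det hg).log hdet).congr_deriv ?_
  rw [Matrix.inv_def, Matrix.smul_mul, Matrix.trace_smul, Ring.inverse_eq_inv', smul_eq_mul,
    div_eq_inv_mul]

open scoped Matrix.Norms.Operator in
theorem hasDerivAt_matrix_inv (hg : HasDerivAt g g' t) (hdet : (g t).det ≠ 0) :
    HasDerivAt (fun s => (g s)⁻¹) (-((g t)⁻¹ * g' * (g t)⁻¹)) t := by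
  obtain ⟨u, hu⟩ := (Matrix.isUnit_iff_isUnit_det (g t)).2 hdet.isUnit
  have hinv : ((u⁻¹ : (Matrix ι ι ℝ)ˣ) : Matrix ι ι ℝ) = (g t)⁻¹ := by
    rw [← hu, Matrix.coe_units_inv]
  have h := (hu ▸ hasFDerivAt_ringInverse (𝕜 := ℝ) u).comp_hasDerivAt t hg
  simp only [Function.comp_def, ← Matrix.nonsing_inv_eq_ringInverse, hinv] at h
  exact h

theorem hasDerivAt_matrix_inv_mul (hg : HasDerivAt g g' t) (hdet : (g t).det ≠ 0)
    (hh : HasDerivAt h h' t) :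
    HasDerivAt (fun s => (g s)⁻¹ * h s)
      ((g t)⁻¹ * h' - (g t)⁻¹ * g' * ((g t)⁻¹ * h t)) t := by
  have hprod := hasDerivAt_matrix_mul (hasDerivAt_matrix_inv hg hdet) hh
  rwa [neg_mul, mul_assoc _ (g t)⁻¹, neg_add_eq_sub] at hprod

end LogDet

section Derivatives

set_option maxSynthPendingDepth 3

variable {E F : Type*} [NormedAddCommGroup E] [NormedSpace ℝ E]
  [NormedAddCommGroup F] [NormedSpace ℝ F]

/-- The second derivative `D²u(x)[v, w]`, in curried form. -/
noncomputable def d2 (u : E → ℝ) : E → E →L[ℝ] E →L[ℝ] ℝ := fderiv ℝ (fderiv ℝ u)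

/-- The third derivative `D³u(x)[v, w, z]`, in curried form. -/
noncomputable def d3 (u : E → ℝ) : E → E →L[ℝ] E →L[ℝ] E →L[ℝ] ℝ := fderiv ℝ (d2 u)

/-- The directional derivative `∂ₑu`, as an operator on functions, so that it can be iterated. -/
noncomputable def dirDeriv (e : E) (u : E → ℝ) : E → ℝ := fun x => fderiv ℝ u x e

theorem iteratedFDeriv_two_eq_d2 (u : E → ℝ) (x v w : E) :
    iteratedFDeriv ℝ 2 u x ![v, w] = d2 u x v w := by
  simp [iteratedFDeriv_two_apply, d2]

theorem iteratedFDeriv_three_eq_d3 (u : E → ℝ) (x v w z : E) :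
    iteratedFDeriv ℝ 3 u x ![v, w, z] = d3 u x v w z := by
  rw [iteratedFDeriv_succ_apply_right, iteratedFDeriv_two_apply]
  rfl

theorem hasDerivAt_comp_line {u : E → F} (hu : Differentiable ℝ u) (x y : E) (t : ℝ) :
    HasDerivAt (fun s : ℝ => u (x + s • y)) (fderiv ℝ u (x + t • y) y) t := by
  have hline : HasDerivAt (fun s : ℝ => x + s • y) y t := by
    simpa using ((hasDerivAt_id t).smul_const y).const_add x
  exact (hu (x + t • y)).hasFDerivAt.comp_hasDerivAt t hline

theorem contDiff_line (x y : E) : ContDiff ℝ ∞ fun t : ℝ => x + t • y := by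
  fun_prop

theorem contDiff_comp_line {u : E → F} (hu : ContDiff ℝ ∞ u) (x y : E) :
    ContDiff ℝ ∞ fun t : ℝ => u (x + t • y) :=
  hu.comp (contDiff_line x y)

theorem fderiv_fderiv_comm {u : E → F} (hu : ContDiff ℝ ∞ u) (x v w : E) :
    fderiv ℝ (fderiv ℝ u) x v w = fderiv ℝ (fderiv ℝ u) x w v :=
  ((contDiff_infty.1 hu 2).contDiffAt.isSymmSndFDerivAt (by simp)).eq v w

variable {u : E → ℝ} (hu : ContDiff ℝ ∞ u)
include hu

theorem contDiff_fderiv : ContDiff ℝ ∞ (fderiv ℝ u) := hu.fderiv_right (by simp)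

theorem contDiff_d2 : ContDiff ℝ ∞ (d2 u) := (contDiff_fderiv hu).fderiv_right (by simp)

theorem contDiff_d3 : ContDiff ℝ ∞ (d3 u) := (contDiff_d2 hu).fderiv_right (by simp)

theorem contDiff_dirDeriv (e : E) : ContDiff ℝ ∞ (dirDeriv e u) :=
  (contDiff_fderiv hu).clm_apply contDiff_const

theorem contDiff_iterate_dirDeriv (e : E) : ∀ k : ℕ, ContDiff ℝ ∞ ((dirDeriv e)^[k] u)
  | 0 => hu
  | k + 1 => by
    rw [Function.iterate_succ_apply']
    exact contDiff_dirDeriv (contDiff_iterate_dirDeriv e k) e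

theorem d2_comm (x v w : E) : d2 u x v w = d2 u x w v := fderiv_fderiv_comm hu x v w

theorem fderiv_dirDeriv (e : E) : fderiv ℝ (dirDeriv e u) = fun x => d2 u x e := by
  ext x v
  have hfderiv := ((contDiff_fderiv hu).differentiable (by simp) x).hasFDerivAt
  unfold dirDeriv
  rw [d2_comm hu x e v, (hfderiv.clm_apply (hasFDerivAt_const e x)).fderiv]
  simp [d2]

theorem d2_dirDeriv (e x v : E) : d2 (dirDeriv e u) x v = d3 u x v e := by
  rw [d2, fderiv_dirDeriv hu]
  have hd2 := ((contDiff_d2 hu).differentiable (by simp) x).hasFDerivAt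
  rw [(hd2.clm_apply (hasFDerivAt_const e x)).fderiv]
  ext w
  simp [d3]

theorem d3_comm_left (x v w z : E) : d3 u x v w z = d3 u x w v z :=
  congrArg (· z) (fderiv_fderiv_comm (contDiff_fderiv hu) x v w)

theorem d3_comm_right (x v w z : E) : d3 u x v w z = d3 u x v z w := by
  have hswap (a b c : E) : d3 u x a b c = d3 u x c b a := by
    rw [← d2_dirDeriv hu, ← d2_dirDeriv hu, d2_comm (contDiff_dirDeriv hu b)]
  rw [hswap, d3_comm_left hu, hswap]

end Derivatives

section Lines

variable {E : Type*} [NormedAddCommGroup E] [NormedSpace ℝ E]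

theorem deriv_deriv_mul {p q : ℝ → ℝ} (hp : ContDiff ℝ ∞ p) (hq : ContDiff ℝ ∞ q) (t : ℝ) :
    deriv (deriv fun s => p s * q s) t
      = deriv (deriv p) t * q t + 2 * (deriv p t * deriv q t) + p t * deriv (deriv q) t := by
  obtain ⟨hp₁, hp₂⟩ := contDiff_infty_iff_deriv.1 hp
  obtain ⟨hq₁, hq₂⟩ := contDiff_infty_iff_deriv.1 hq
  replace hp₂ := hp₂.differentiable (by simp) t
  replace hq₂ := hq₂.differentiable (by simp) t
  have hderiv : deriv (fun s => p s * q s) = fun s => deriv p s * q s + p s * deriv q s :=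
    funext fun s => deriv_fun_mul (hp₁ s) (hq₁ s)
  rw [hderiv, deriv_fun_add (hp₂.fun_mul (hq₁ t)) ((hp₁ t).fun_mul hq₂),
    deriv_fun_mul hp₂ (hq₁ t), deriv_fun_mul (hp₁ t) hq₂]
  ring

theorem deriv_add_mul_zero {p q : ℝ → ℝ} (hp : DifferentiableAt ℝ p 0)
    (hq : DifferentiableAt ℝ q 0) :
    deriv (fun t => p t + t * q t) 0 = deriv p 0 + q 0 := by
  rw [deriv_fun_add hp (differentiableAt_fun_id.fun_mul hq),
    deriv_fun_mul differentiableAt_fun_id hq]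
  simp

theorem deriv_deriv_add_mul_zero {p q : ℝ → ℝ} (hp : ContDiff ℝ ∞ p) (hq : ContDiff ℝ ∞ q) :
    deriv (deriv fun t => p t + t * q t) 0 = deriv (deriv p) 0 + 2 * deriv q 0 := by
  have hmul : ContDiff ℝ ∞ fun t => t * q t := contDiff_fun_id.mul hq
  have hadd : deriv (fun t => p t + t * q t) = fun t => deriv p t + deriv (fun s => s * q s) t :=
    funext fun t => deriv_fun_add (hp.differentiable (by simp) t) (hmul.differentiable (by simp) t)
  rw [hadd, deriv_fun_add ((contDiff_infty_iff_deriv.1 hp).2.differentiable (by simp) 0)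
    ((contDiff_infty_iff_deriv.1 hmul).2.differentiable (by simp) 0),
    deriv_deriv_mul contDiff_fun_id hq]
  simp

theorem deriv_deriv_mul_tangent {p q : ℝ → ℝ} (hp : ContDiff ℝ ∞ p) (hq : ContDiff ℝ ∞ q)
    (hq₀ : q 0 = 1) (hq₁ : deriv q 0 = 0) :
    deriv (deriv fun t => p t * ((5 - 3 * q t) / 2)) 0
      = deriv (deriv p) 0 - 3 / 2 * p 0 * deriv (deriv q) 0 := by
  have hderiv : deriv (fun t => (5 - 3 * q t) / 2) = fun t => -(3 / 2) * deriv q t := by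
    ext t
    rw [deriv_div_const, deriv_const_sub, deriv_const_mul_field]
    ring
  rw [deriv_deriv_mul hp ((contDiff_const.sub (contDiff_const.mul hq)).div_const 2), hderiv,
    deriv_const_mul_field, hq₀]
  linear_combination -3 * deriv p 0 * hq₁

variable {u : E → ℝ} (hu : ContDiff ℝ ∞ u)
include hu

theorem deriv_comp_line (x y : E) :
    deriv (fun t : ℝ => u (x + t • y)) = fun t => dirDeriv y u (x + t • y) :=
  funext fun t => (hasDerivAt_comp_line (hu.differentiable (by simp)) x y t).deriv

theorem hasDerivAt_iterate_dirDeriv (e x : E) (k : ℕ) :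
    HasDerivAt (fun t : ℝ => (dirDeriv e)^[k] u (x + t • e)) ((dirDeriv e)^[k + 1] u x) 0 := by
  have hline := hasDerivAt_comp_line
    ((contDiff_iterate_dirDeriv hu e k).differentiable (by simp)) x e 0
  rwa [zero_smul, add_zero, ← dirDeriv, ← Function.iterate_succ_apply' (dirDeriv e)] at hline

theorem dirDeriv_dirDeriv (e w x : E) : dirDeriv w (dirDeriv e u) x = d2 u x e w :=
  congrArg (· x w) (fderiv_dirDeriv hu e)

theorem deriv_deriv_comp_line (x y : E) (t : ℝ) :
    deriv (deriv fun t : ℝ => u (x + t • y)) t = d2 u (x + t • y) y y := by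
  rw [deriv_comp_line hu, deriv_comp_line (contDiff_dirDeriv hu y)]
  exact dirDeriv_dirDeriv hu y y _

theorem d2_nonneg_of_convexOn (hconvex : ConvexOn ℝ Set.univ u) (x v : E) : 0 ≤ d2 u x v v := by
  have hline : ConvexOn ℝ Set.univ fun t : ℝ => u (x + t • v) := by
    simpa [Function.comp_def, AffineMap.lineMap_apply, add_comm] using
      hconvex.comp_affineMap (AffineMap.lineMap x (x + v))
  have hmono := hline.monotoneOn_deriv fun t _ =>
    (contDiff_comp_line hu x v).differentiable (by simp) t
  simpa [deriv_deriv_comp_line hu] using (monotoneOn_univ.1 hmono).deriv_nonneg (x := 0)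

end Lines

section Frames

open LinearMap (BilinForm)
open LinearMap.BilinForm (toMatrix toMatrix_mul_basis_toMatrix)

variable {K V ι : Type*} [Fintype ι] [DecidableEq ι]

theorem trace_inv_toMatrix_mul_toMatrix [Field K] [AddCommGroup V] [Module K V]
    (b c : Module.Basis ι K V) (B C : BilinForm K V) :
    ((toMatrix c B)⁻¹ * toMatrix c C).trace
      = ((toMatrix b B)⁻¹ * toMatrix b C).trace := by
  have hP : IsUnit (b.toMatrix c).det :=
    Matrix.isUnit_det_of_right_inverse (b.toMatrix_mul_toMatrix_flip c)
  have hPt : IsUnit (b.toMatrix c).transpose.det := by rwa [Matrix.det_transpose]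
  rw [← toMatrix_mul_basis_toMatrix b c B,
    ← toMatrix_mul_basis_toMatrix b c C, Matrix.mul_inv_rev,
    Matrix.mul_inv_rev, Matrix.mul_assoc, Matrix.mul_assoc _ (b.toMatrix c).transpose⁻¹,
    Matrix.mul_assoc (b.toMatrix c).transpose, Matrix.nonsing_inv_mul_cancel_left _ _ hPt,
    Matrix.trace_mul_comm, Matrix.mul_assoc, Matrix.mul_assoc, Matrix.mul_nonsing_inv _ hP,
    Matrix.mul_one]

section Endomorphism

variable {R M : Type*} [CommRing R] [AddCommGroup M] [Module R M] {b : Module.Basis ι R M}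
  {g h : BilinForm R M} {A : M →ₗ[R] M}

theorem toMatrix_transpose_eq_of_apply_eq (hb : toMatrix b g = 1)
    (hA : ∀ v w, g (A v) w = h v w) : (LinearMap.toMatrix b b A).transpose = toMatrix b h := by
  have hcomp : h = g.compLeft A := LinearMap.BilinForm.ext fun v w => (hA v w).symm
  rw [hcomp, LinearMap.BilinForm.toMatrix_compLeft, hb, Matrix.mul_one]

theorem sum_apply_map_self (hb : toMatrix b g = 1) (hA : ∀ v w, g (A v) w = h v w)
    (C : BilinForm R M) :
    ∑ k, C (A (b k)) (b k) = (toMatrix b h * toMatrix b C).trace := by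
  rw [← toMatrix_transpose_eq_of_apply_eq hb hA, ← LinearMap.BilinForm.toMatrix_compLeft]
  simp [Matrix.trace, LinearMap.BilinForm.toMatrix_apply]

theorem sum_apply_map_map (hb : toMatrix b g = 1) (hA : ∀ v w, g (A v) w = h v w)
    (hh : h.IsSymm) (C : BilinForm R M) :
    ∑ k, C (A (b k)) (A (b k)) = (toMatrix b h * toMatrix b h * toMatrix b C).trace := by
  have hAt := toMatrix_transpose_eq_of_apply_eq hb hA
  have hAh : LinearMap.toMatrix b b A = toMatrix b h := by
    rw [← (LinearMap.BilinForm.isSymm_toMatrix_iff_isSymm b).2 hh, ← hAt,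
      Matrix.transpose_transpose]
  calc ∑ k, C (A (b k)) (A (b k)) = (toMatrix b (C.comp A A)).trace := by
        simp [Matrix.trace, LinearMap.BilinForm.toMatrix_apply]
    _ = (toMatrix b h * toMatrix b h * toMatrix b C).trace := by
        rw [LinearMap.BilinForm.toMatrix_comp b b, hAt, hAh, Matrix.trace_mul_comm,
          ← Matrix.mul_assoc]

end Endomorphism

variable [AddCommGroup V] [Module ℝ V]

theorem nondegenerate_of_pos {B : BilinForm ℝ V} (hpos : ∀ v, v ≠ 0 → 0 < B v v) :
    B.Nondegenerate :=
  ⟨fun v hv => by_contra fun hne => (hpos v hne).ne' (hv v),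
    fun v hv => by_contra fun hne => (hpos v hne).ne' (hv v)⟩

theorem apply_self_nonneg_of_pos {B : BilinForm ℝ V} (hpos : ∀ v, v ≠ 0 → 0 < B v v) (v : V) :
    0 ≤ B v v := by
  rcases eq_or_ne v 0 with rfl | hv
  · simp
  · exact (hpos v hv).le

theorem exists_basis_toMatrix_eq_one [FiniteDimensional ℝ V] {B : BilinForm ℝ V}
    (hsymm : B.IsSymm) (hpos : ∀ v, v ≠ 0 → 0 < B v v)
    (hcard : Module.finrank ℝ V = Fintype.card ι) (i₀ : ι) {e : V} (he : B e e = 1) :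
    ∃ b : Module.Basis ι ℝ V, b i₀ = e ∧ toMatrix b B = 1 := by
  let core : InnerProductSpace.Core ℝ V :=
    { inner := fun v w => B v w
      conj_inner_symm := fun v w => hsymm.eq w v
      re_inner_nonneg := apply_self_nonneg_of_pos hpos
      add_left := fun v w z => by simp
      smul_left := fun v w r => by simp
      definite := fun v hv => by_contra fun hne => (hpos v hne).ne' hv }
  let : NormedAddCommGroup V := core.toNormedAddCommGroup
  let : InnerProductSpace ℝ V := .ofCore core.toCore
  have hunit : Orthonormal ℝ (({i₀} : Set ι).domRestrict fun _ => e) :=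
    orthonormal_iff_ite.2 fun i j => by
      rw [if_pos (Subsingleton.elim i j)]
      exact he
  obtain ⟨b, hb⟩ := hunit.exists_orthonormalBasis_extension_of_card_eq hcard
  refine ⟨b.toBasis, by simpa using hb i₀ rfl, ?_⟩
  ext i j
  rw [LinearMap.BilinForm.toMatrix_apply, Matrix.one_apply,
    ← orthonormal_iff_ite.1 b.orthonormal i j, b.coe_toBasis]
  rfl

end Frames

section Equation

open LinearMap.BilinForm (toMatrix)

variable {E ι : Type*} [NormedAddCommGroup E] [NormedSpace ℝ E] [Fintype ι] [DecidableEq ι]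

/-- The matrix of the Hessian form `D²u(z)` in the basis `b`. -/
noncomputable def hessianIn (b : Module.Basis ι ℝ E) (u : E → ℝ) (z : E) : Matrix ι ι ℝ :=
  toMatrix b (d2 u z).toBilinForm

/-- The Hessian of `u` relative to that of `Φ`, that is `(D²Φ)⁻¹ D²u` in the basis `b`. Its trace
is the weighted Laplacian `Lu`. -/
noncomputable def relHessian (b : Module.Basis ι ℝ E) (Φ u : E → ℝ) (z : E) : Matrix ι ι ℝ :=
  (hessianIn b Φ z)⁻¹ * hessianIn b u z

variable {Φ u : E → ℝ} (hΦ : ContDiff ℝ ∞ Φ) (hu : ContDiff ℝ ∞ u) {b : Module.Basis ι ℝ E}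

include hu in
theorem hasDerivAt_hessianIn (x e : E) :
    HasDerivAt (fun t : ℝ => hessianIn b u (x + t • e)) (hessianIn b (dirDeriv e u) x) 0 := by
  refine hasDerivAt_pi.2 fun i => hasDerivAt_pi.2 fun j => ?_
  have hline := hasDerivAt_comp_line ((contDiff_d2 hu).differentiable (by simp)) x e 0
  have hentry := (hline.clm_apply (hasDerivAt_const 0 (b i))).clm_apply (hasDerivAt_const 0 (b j))
  simp only [hessianIn, LinearMap.BilinForm.toMatrix_apply, d2_dirDeriv hu,
    ContinuousLinearMap.toBilinForm_apply, d3_comm_left hu x (b i)]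
  simpa [d3] using hentry

include hΦ hu in
theorem hasDerivAt_relHessian {x : E} (hdet : (hessianIn b Φ x).det ≠ 0) (e : E) :
    HasDerivAt (fun t : ℝ => relHessian b Φ u (x + t • e))
      (relHessian b Φ (dirDeriv e u) x
        - relHessian b Φ (dirDeriv e Φ) x * relHessian b Φ u x) 0 := by
  have hderiv := hasDerivAt_matrix_inv_mul (hasDerivAt_hessianIn (b := b) hΦ x e)
    (by simpa using hdet) (hasDerivAt_hessianIn (b := b) hu x e)
  simp only [zero_smul, add_zero] at hderiv
  exact hderiv

variable {c : ℝ} (hc : c ≠ 0) (hdet : ∀ z, (hessianIn b Φ z).det = c * Real.exp (-Φ z))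
include hΦ hc hdet

theorem trace_relHessian_dirDeriv (e z : E) :
    (relHessian b Φ (dirDeriv e Φ) z).trace = -dirDeriv e Φ z := by
  have hlog (t : ℝ) : Real.log (hessianIn b Φ (z + t • e)).det = Real.log c - Φ (z + t • e) := by
    rw [hdet, Real.log_mul hc (Real.exp_ne_zero _), Real.log_exp, sub_eq_add_neg]
  have hleft := hasDerivAt_log_det (hasDerivAt_hessianIn (b := b) hΦ z e)
    (by rw [hdet]; exact mul_ne_zero hc (Real.exp_ne_zero _))
  simp only [hlog, zero_smul, add_zero] at hleft
  exact hleft.unique ((hasDerivAt_iterate_dirDeriv hΦ e z 0).const_sub _)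

theorem trace_relHessian_dirDeriv_two (e z : E) :
    (relHessian b Φ ((dirDeriv e)^[2] Φ) z).trace
      = ((relHessian b Φ (dirDeriv e Φ) z) ^ 2).trace - (dirDeriv e)^[2] Φ z := by
  have hne : (hessianIn b Φ z).det ≠ 0 := hdet z ▸ mul_ne_zero hc (Real.exp_ne_zero _)
  have hleft := hasDerivAt_matrix_trace
    (hasDerivAt_relHessian hΦ (contDiff_iterate_dirDeriv hΦ e 1) hne e)
  have h := hleft.unique ((hasDerivAt_iterate_dirDeriv hΦ e z 1).fun_neg.congr_of_eventuallyEq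
    (.of_forall fun t => trace_relHessian_dirDeriv hΦ hc hdet e (z + t • e)))
  rw [Matrix.trace_sub, sub_eq_iff_eq_add'] at h
  rw [pow_two]
  exact h

theorem trace_relHessian_dirDeriv_three (e z : E) :
    (relHessian b Φ ((dirDeriv e)^[3] Φ) z).trace
      = 3 * (relHessian b Φ (dirDeriv e Φ) z * relHessian b Φ ((dirDeriv e)^[2] Φ) z).trace
        - 2 * ((relHessian b Φ (dirDeriv e Φ) z) ^ 3).trace - (dirDeriv e)^[3] Φ z := by
  have hne : (hessianIn b Φ z).det ≠ 0 := hdet z ▸ mul_ne_zero hc (Real.exp_ne_zero _)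
  have hN₁ := hasDerivAt_relHessian hΦ (contDiff_iterate_dirDeriv hΦ e 1) hne e
  have hN₂ := hasDerivAt_relHessian hΦ (contDiff_iterate_dirDeriv hΦ e 2) hne e
  have hright := (hasDerivAt_matrix_trace (hasDerivAt_matrix_mul hN₁ hN₁)).fun_sub
    (hasDerivAt_iterate_dirDeriv hΦ e z 2)
  simp only [← pow_two] at hright
  have h := (hasDerivAt_matrix_trace hN₂).unique (hright.congr_of_eventuallyEq
    (.of_forall fun t => trace_relHessian_dirDeriv_two hΦ hc hdet e (z + t • e)))
  simp only [Function.iterate_succ_apply', Function.iterate_zero_apply, Matrix.trace_sub,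
    Matrix.trace_add, zero_smul, add_zero, Matrix.sub_mul, Matrix.mul_sub, mul_assoc,
    pow_three] at h ⊢
  rw [Matrix.trace_mul_comm (relHessian b Φ (dirDeriv e (dirDeriv e Φ)) z)] at h
  linear_combination h

end Equation

section Frame

variable {E ι : Type*} [NormedAddCommGroup E] [NormedSpace ℝ E] [Fintype ι] [DecidableEq ι]
  {Φ : E → ℝ} (hΦ : ContDiff ℝ ∞ Φ) {b : Module.Basis ι ℝ E} {c : ℝ} (hc : c ≠ 0)
  (hdet : ∀ z, (hessianIn b Φ z).det = c * Real.exp (-Φ z)) {x e : E} {A : E →L[ℝ] E}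
  (hb : hessianIn b Φ x = 1) (hA : ∀ v w, d2 Φ x (A v) w = d2 (dirDeriv e Φ) x v w)

theorem trace_hessianIn (b : Module.Basis ι ℝ E) (u : E → ℝ) (x : E) :
    (hessianIn b u x).trace = ∑ k, d2 u x (b k) (b k) := by
  simp [hessianIn, Matrix.trace, LinearMap.BilinForm.toMatrix_apply]

include hb

theorem relHessian_eq_hessianIn (u : E → ℝ) : relHessian b Φ u x = hessianIn b u x := by
  rw [relHessian, hb, inv_one, one_mul]

include hA

theorem sum_d2_map_self (u : E → ℝ) :
    ∑ k, d2 u x (A (b k)) (b k) = (hessianIn b (dirDeriv e Φ) x * hessianIn b u x).trace :=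
  sum_apply_map_self (h := (d2 (dirDeriv e Φ) x).toBilinForm) (A := (A : E →ₗ[ℝ] E)) hb hA
    (d2 u x).toBilinForm

include hΦ

theorem sum_d2_map_map (u : E → ℝ) :
    ∑ k, d2 u x (A (b k)) (A (b k))
      = (hessianIn b (dirDeriv e Φ) x * hessianIn b (dirDeriv e Φ) x
        * hessianIn b u x).trace :=
  sum_apply_map_map (h := (d2 (dirDeriv e Φ) x).toBilinForm) (A := (A : E →ₗ[ℝ] E)) hb hA
    ⟨d2_comm (contDiff_dirDeriv hΦ e) x⟩ (d2 u x).toBilinForm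

include hc hdet

theorem sum_d2_dirDeriv_two :
    ∑ k, d2 ((dirDeriv e)^[2] Φ) x (b k) (b k)
      = ∑ k, d2 Φ x (A (b k)) (A (b k)) - (dirDeriv e)^[2] Φ x := by
  have htrace := trace_relHessian_dirDeriv_two hΦ hc hdet e x
  rwa [relHessian_eq_hessianIn hb, relHessian_eq_hessianIn hb, trace_hessianIn, pow_two,
    ← mul_one (_ * _), ← hb, ← sum_d2_map_map hΦ hb hA] at htrace

theorem sum_d2_dirDeriv_three :
    ∑ k, d2 ((dirDeriv e)^[3] Φ) x (b k) (b k)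
      = 3 * ∑ k, d2 ((dirDeriv e)^[2] Φ) x (A (b k)) (b k)
        - 2 * ∑ k, d2 (dirDeriv e Φ) x (A (b k)) (A (b k)) - (dirDeriv e)^[3] Φ x := by
  have htrace := trace_relHessian_dirDeriv_three hΦ hc hdet e x
  simp only [relHessian_eq_hessianIn hb] at htrace
  rwa [trace_hessianIn, pow_three', ← sum_d2_map_map hΦ hb hA, ← sum_d2_map_self hb hA] at htrace

end Frame

section Barrier

set_option maxSynthPendingDepth 3

variable {E F : Type*} [NormedAddCommGroup E] [NormedSpace ℝ E]
  [NormedAddCommGroup F] [NormedSpace ℝ F]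

theorem exists_clm_apply_eq [FiniteDimensional ℝ E] {g : E →L[ℝ] E →L[ℝ] ℝ}
    (hpos : ∀ v, v ≠ 0 → 0 < g v v) (h : E →L[ℝ] E →L[ℝ] ℝ) :
    ∃ A : E →L[ℝ] E, ∀ v w, g (A v) w = h v w := by
  have hg : g.toBilinForm.Nondegenerate := nondegenerate_of_pos hpos
  refine ⟨((g.toBilinForm.toDual hg).symm.toLinearMap ∘ₗ h.toBilinForm).toContinuousLinearMap,
    fun v w => ?_⟩
  exact LinearMap.BilinForm.apply_toDual_symm_apply (hB := hg) (f := h.toBilinForm v) w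

/-- The vector field with value `e` at `x₀` and constant derivative `-A/2`. If `D²Φ(x₀)` turns `A`
into the Hessian form of `∂ₑΦ`, then `A/2` is the Christoffel symbol of the metric `D²Φ` at `x₀`
contracted with `e`, and the field is parallel at `x₀` to first order. -/
noncomputable def parallelField (A : E →L[ℝ] E) (x₀ e x : E) : E := e - (1 / 2 : ℝ) • A (x - x₀)

/-- The barrier at `x₀`: the normalized third derivative `D³Φ(ε, ε, ε) / D²Φ(ε, ε)^{3/2}` along
`ε = parallelField A x₀ e`, in which `q ↦ q^{-3/2}` is replaced by its tangent `(5 - 3 q) / 2` at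
`q = 1`, so that `φ` is smooth everywhere. -/
noncomputable def barrier (Φ : E → ℝ) (A : E →L[ℝ] E) (x₀ e x : E) : ℝ :=
  d3 Φ x (parallelField A x₀ e x) (parallelField A x₀ e x) (parallelField A x₀ e x)
    * ((5 - 3 * d2 Φ x (parallelField A x₀ e x) (parallelField A x₀ e x)) / 2)

/-- The points at which the factor `(5 - 3 q) / 2` of `barrier Φ A x₀ e` is positive. -/
def barrierDomain (Φ : E → ℝ) (A : E →L[ℝ] E) (x₀ e : E) : Set E :=
  {x | 3 * d2 Φ x (parallelField A x₀ e x) (parallelField A x₀ e x) < 5}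

theorem parallelField_self (A : E →L[ℝ] E) (x e : E) : parallelField A x e x = e := by
  simp [parallelField]

theorem parallelField_add_smul (A : E →L[ℝ] E) (x e y : E) (t : ℝ) :
    parallelField A x e (x + t • y) = e + t • (-(1 / 2 : ℝ)) • A y := by
  rw [parallelField, add_sub_cancel_left, map_smul, smul_comm, neg_smul, smul_neg,
    sub_eq_add_neg]

theorem contDiff_parallelField (A : E →L[ℝ] E) (x e : E) : ContDiff ℝ ∞ (parallelField A x e) := by
  unfold parallelField
  fun_prop

theorem mem_barrierDomain_self {Φ : E → ℝ} {x e : E} (A : E →L[ℝ] E) (he : d2 Φ x e e = 1) :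
    x ∈ barrierDomain Φ A x e := by
  norm_num [barrierDomain, parallelField_self, he]

theorem barrier_self {Φ : E → ℝ} {x e : E} (A : E →L[ℝ] E) (he : d2 Φ x e e = 1) :
    barrier Φ A x e x = d3 Φ x e e e := by
  norm_num [barrier, parallelField_self, he]

variable {Φ : E → ℝ} (hΦ : ContDiff ℝ ∞ Φ)
include hΦ

theorem contDiff_d2_apply {p v : F → E} (hp : ContDiff ℝ ∞ p) (hv : ContDiff ℝ ∞ v) :
    ContDiff ℝ ∞ fun s => d2 Φ (p s) (v s) (v s) :=
  (((contDiff_d2 hΦ).comp hp).clm_apply hv).clm_apply hv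

theorem contDiff_d3_apply {p v : F → E} (hp : ContDiff ℝ ∞ p) (hv : ContDiff ℝ ∞ v) :
    ContDiff ℝ ∞ fun s => d3 Φ (p s) (v s) (v s) (v s) :=
  ((((contDiff_d3 hΦ).comp hp).clm_apply hv).clm_apply hv).clm_apply hv

theorem contDiff_barrier (A : E →L[ℝ] E) (x e : E) : ContDiff ℝ ∞ (barrier Φ A x e) := by
  have hε := contDiff_parallelField A x e
  exact (contDiff_d3_apply hΦ contDiff_id hε).mul ((contDiff_const.sub
    (contDiff_const.mul (contDiff_d2_apply hΦ contDiff_id hε))).div_const 2)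

theorem isOpen_barrierDomain (A : E →L[ℝ] E) (x e : E) : IsOpen (barrierDomain Φ A x e) :=
  isOpen_lt (continuous_const.mul
    (contDiff_d2_apply hΦ contDiff_id (contDiff_parallelField A x e)).continuous) continuous_const

theorem d2_add_smul (z e w : E) (t : ℝ) :
    d2 Φ z (e + t • w) (e + t • w)
      = (dirDeriv e)^[2] Φ z + t * (2 * dirDeriv w (dirDeriv e Φ) z + t * d2 Φ z w w) := by
  simp only [Function.iterate_succ_apply', Function.iterate_zero_apply, dirDeriv_dirDeriv hΦ,
    map_add, map_smul, add_apply, smul_apply, smul_eq_mul, d2_comm hΦ z w e]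
  ring

theorem d3_add_smul (z e w : E) (t : ℝ) :
    d3 Φ z (e + t • w) (e + t • w) (e + t • w)
      = (dirDeriv e)^[3] Φ z + t * (3 * dirDeriv w ((dirDeriv e)^[2] Φ) z
        + t * (3 * d2 (dirDeriv e Φ) z w w + t * d3 Φ z w w w)) := by
  have hΦ₁ := contDiff_dirDeriv hΦ e
  simp only [Function.iterate_succ_apply', Function.iterate_zero_apply,
    dirDeriv_dirDeriv hΦ₁, d2_dirDeriv hΦ]
  simp only [map_add, map_smul, add_apply, smul_apply, smul_eq_mul, d3_comm_left hΦ z w e,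
    d3_comm_right hΦ z e w e, d3_comm_right hΦ z w w e]
  ring

theorem deriv_d2_line (x y e w : E) :
    deriv (fun t : ℝ => d2 Φ (x + t • y) (e + t • w) (e + t • w)) 0
      = d2 (dirDeriv e Φ) x e y + 2 * d2 Φ x e w := by
  have hΦ₁ := contDiff_dirDeriv hΦ e
  have hΦ₂ := contDiff_iterate_dirDeriv hΦ e 2
  have hmixed := contDiff_comp_line (contDiff_dirDeriv hΦ₁ w) x y
  have hquad := contDiff_d2_apply hΦ (contDiff_line x y) (contDiff_const (c := w))
  simp only [d2_add_smul hΦ]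
  rw [deriv_add_mul_zero ((contDiff_comp_line hΦ₂ x y).differentiable (by simp) 0)
    (((contDiff_const.mul hmixed).add (contDiff_fun_id.mul hquad)).differentiable (by simp) 0),
    deriv_comp_line hΦ₂]
  simp only [Function.iterate_succ_apply', Function.iterate_zero_apply, dirDeriv_dirDeriv hΦ,
    dirDeriv_dirDeriv hΦ₁, zero_smul, add_zero, zero_mul]

theorem deriv_deriv_d2_line (x y e w : E) :
    deriv (deriv fun t : ℝ => d2 Φ (x + t • y) (e + t • w) (e + t • w)) 0
      = d2 ((dirDeriv e)^[2] Φ) x y y + 4 * d2 (dirDeriv e Φ) x w y + 2 * d2 Φ x w w := by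
  have hΦ₂ := contDiff_iterate_dirDeriv hΦ e 2
  have hΦ₁w := contDiff_dirDeriv (contDiff_dirDeriv hΦ e) w
  have hmixed := (contDiff_const (c := (2 : ℝ))).mul (contDiff_comp_line hΦ₁w x y)
  have hquad := contDiff_d2_apply hΦ (contDiff_line x y) (contDiff_const (c := w))
  simp only [d2_add_smul hΦ]
  rw [deriv_deriv_add_mul_zero (contDiff_comp_line hΦ₂ x y)
      (hmixed.add (contDiff_fun_id.mul hquad)),
    deriv_add_mul_zero (hmixed.differentiable (by simp) 0) (hquad.differentiable (by simp) 0),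
    deriv_deriv_comp_line hΦ₂, deriv_const_mul_field', deriv_comp_line hΦ₁w]
  simp only [dirDeriv_dirDeriv (contDiff_dirDeriv hΦ e), zero_smul, add_zero]
  ring

theorem deriv_deriv_d3_line (x y e w : E) :
    deriv (deriv fun t : ℝ => d3 Φ (x + t • y) (e + t • w) (e + t • w) (e + t • w)) 0
      = d2 ((dirDeriv e)^[3] Φ) x y y + 6 * d2 ((dirDeriv e)^[2] Φ) x w y
        + 6 * d2 (dirDeriv e Φ) x w w := by
  have hΦ₂ := contDiff_iterate_dirDeriv hΦ e 2
  have hΦ₃ := contDiff_iterate_dirDeriv hΦ e 3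
  have hΦ₂w := contDiff_dirDeriv hΦ₂ w
  have hmixed := (contDiff_const (c := (3 : ℝ))).mul (contDiff_comp_line hΦ₂w x y)
  have hcubic := ((contDiff_const (c := (3 : ℝ))).mul (contDiff_d2_apply
    (contDiff_dirDeriv hΦ e) (contDiff_line x y) (contDiff_const (c := w)))).add
      (contDiff_fun_id.mul (contDiff_d3_apply hΦ (contDiff_line x y) (contDiff_const (c := w))))
  simp only [d3_add_smul hΦ]
  rw [deriv_deriv_add_mul_zero (contDiff_comp_line hΦ₃ x y)
      (hmixed.add (contDiff_fun_id.mul hcubic)),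
    deriv_add_mul_zero (hmixed.differentiable (by simp) 0) (hcubic.differentiable (by simp) 0),
    deriv_deriv_comp_line hΦ₃, deriv_const_mul_field', deriv_comp_line hΦ₂w]
  simp only [dirDeriv_dirDeriv hΦ₂, zero_smul, add_zero, zero_mul]
  ring

variable {x e : E} {A : E →L[ℝ] E} (hA : ∀ v w, d2 Φ x (A v) w = d2 (dirDeriv e Φ) x v w)
  (he : d2 Φ x e e = 1)
include hA he

theorem d2_barrier (y : E) :
    d2 (barrier Φ A x e) x y y
      = d2 ((dirDeriv e)^[3] Φ) x y y - 3 * d2 ((dirDeriv e)^[2] Φ) x (A y) y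
        + 3 / 2 * d2 (dirDeriv e Φ) x (A y) (A y)
        - 3 / 2 * d3 Φ x e e e
          * (d2 ((dirDeriv e)^[2] Φ) x y y - 3 / 2 * d2 Φ x (A y) (A y)) := by
  set w := (-(1 / 2 : ℝ)) • A y with hw
  have hε : ContDiff ℝ ∞ fun t : ℝ => e + t • w := contDiff_line e w
  have hmetric : deriv (fun t : ℝ => d2 Φ (x + t • y) (e + t • w) (e + t • w)) 0 = 0 := by
    rw [deriv_d2_line hΦ, d2_comm (contDiff_dirDeriv hΦ e), ← hA, d2_comm hΦ x e, hw, map_smul,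
      smul_apply, smul_eq_mul]
    ring
  have hline := deriv_deriv_comp_line (contDiff_barrier hΦ A x e) x y 0
  simp only [zero_smul, add_zero, barrier, parallelField_add_smul, ← hw] at hline
  rw [deriv_deriv_mul_tangent (contDiff_d3_apply hΦ (contDiff_line x y) hε)
    (contDiff_d2_apply hΦ (contDiff_line x y) hε) (by simpa using he) hmetric,
    deriv_deriv_d2_line hΦ, deriv_deriv_d3_line hΦ] at hline
  rw [← hline, hw]
  simp only [map_smul, smul_apply, smul_eq_mul, zero_smul, add_zero,
    d2_comm (contDiff_dirDeriv hΦ e) x (A y) y, ← hA y]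
  ring

theorem sum_d2_barrier {ι : Type*} [Fintype ι] [DecidableEq ι] {b : Module.Basis ι ℝ E} {c : ℝ}
    (hc : c ≠ 0) (hdet : ∀ z, (hessianIn b Φ z).det = c * Real.exp (-Φ z))
    (hb : hessianIn b Φ x = 1) :
    ∑ k, d2 (barrier Φ A x e) x (b k) (b k)
      = 1 / 2 * d3 Φ x e e e + 3 / 4 * d3 Φ x e e e * ∑ k, d2 Φ x (A (b k)) (A (b k))
        - 1 / 2 * ∑ k, d3 Φ x e (A (b k)) (A (b k)) := by
  have hΦ₁ := contDiff_dirDeriv hΦ e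
  have htwo : (dirDeriv e)^[2] Φ x = 1 := (dirDeriv_dirDeriv hΦ e e x).trans he
  have hthree : (dirDeriv e)^[3] Φ x = d3 Φ x e e e :=
    (dirDeriv_dirDeriv hΦ₁ e e x).trans (by rw [d2_dirDeriv hΦ])
  have hcubic (v : E) : d3 Φ x e v v = d2 (dirDeriv e Φ) x v v := by
    rw [d2_dirDeriv hΦ, d3_comm_left hΦ, d3_comm_right hΦ]
  simp only [d2_barrier hΦ hA he, hcubic, Finset.sum_sub_distrib, Finset.sum_add_distrib,
    ← Finset.mul_sum, sum_d2_dirDeriv_two hΦ hc hdet hb hA, htwo, hthree,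
    sum_d2_dirDeriv_three hΦ hc hdet hb hA]
  ring

end Barrier

section Maximizer

theorem deriv_deriv_nonneg_of_isLocalMin {p : ℝ → ℝ} {t : ℝ} (hmin : IsLocalMin p t)
    (hcont : ContinuousAt p t) : 0 ≤ deriv (deriv p) t := by
  by_contra! hneg
  have hmax := isLocalMax_of_deriv_deriv_neg hneg hmin.deriv_eq_zero hcont
  have hconst : p =ᶠ[nhds t] fun _ => p t := by
    filter_upwards [hmin, hmax] with s hle hge using le_antisymm hge hle
  have hzero := hconst.deriv.deriv_eq
  simp only [deriv_const'] at hzero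
  exact hneg.ne hzero

theorem hasDerivAt_sqrt_one_add_mul_sq_pow_three {m : ℝ} (hm : 0 ≤ m) (t : ℝ) :
    HasDerivAt (fun s => √(1 + m * s ^ 2) ^ 3) (3 * m * t * √(1 + m * t ^ 2)) t := by
  have hpos : 0 < 1 + m * t ^ 2 := by positivity
  have hinner : HasDerivAt (fun s => 1 + m * s ^ 2) (m * (2 * t)) t := by
    simpa using ((hasDerivAt_pow 2 t).const_mul m).const_add 1
  refine ((hinner.sqrt hpos.ne').fun_pow 3).congr_deriv ?_
  have hsqrt := (Real.sqrt_pos.2 hpos).ne'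
  push_cast
  field_simp

theorem coeff_conditions_of_cubic_le {f a b c m : ℝ} (hm : 0 ≤ m)
    (h : ∀ t, f + 3 * a * t + 3 * b * t ^ 2 + c * t ^ 3 ≤ f * √(1 + m * t ^ 2) ^ 3) :
    a = 0 ∧ b ≤ f / 2 * m := by
  let p (t : ℝ) := f * √(1 + m * t ^ 2) ^ 3 - (f + 3 * a * t + 3 * b * t ^ 2 + c * t ^ 3)
  let q (t : ℝ) := 3 * f * m * √(1 + m * t ^ 2) - 6 * b - 3 * c * t
  have hp (t : ℝ) : HasDerivAt p (-(3 * a) + t * q t) t := by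
    have hcubic := ((((hasDerivAt_id t).const_mul (3 * a)).const_add f).add
      ((hasDerivAt_pow 2 t).const_mul (3 * b))).add ((hasDerivAt_pow 3 t).const_mul c)
    refine (((hasDerivAt_sqrt_one_add_mul_sq_pow_three hm t).const_mul f).sub hcubic).congr_deriv ?_
    push_cast
    ring
  have hq : DifferentiableAt ℝ q 0 :=
    (((DifferentiableAt.sqrt (by fun_prop) (by simp)).const_mul _).sub_const _).fun_sub
      (by fun_prop)
  have hmin : IsLocalMin p 0 := .of_forall fun t => by
    simpa [p] using h t
  have hfirst := hmin.hasDerivAt_eq_zero (hp 0)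
  have hsecond := deriv_deriv_nonneg_of_isLocalMin hmin (hp 0).continuousAt
  rw [funext fun t => (hp t).deriv, deriv_add_mul_zero (differentiableAt_const _) hq] at hsecond
  simp only [deriv_const', q, ne_eq, OfNat.ofNat_ne_zero, not_false_eq_true, zero_pow, mul_zero,
    add_zero, Real.sqrt_one, zero_mul] at hfirst hsecond
  constructor <;> linarith

set_option maxSynthPendingDepth 3

variable {E : Type*} [NormedAddCommGroup E] [NormedSpace ℝ E] {Φ : E → ℝ}
  (hΦ : ContDiff ℝ ∞ Φ) {x e : E} {f : ℝ} (hpos : ∀ v, v ≠ 0 → 0 < d2 Φ x v v)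
  (hle : ∀ v, d3 Φ x v v v ≤ f * √(d2 Φ x v v) ^ 3) (he : d2 Φ x e e = 1)
  (hmax : d3 Φ x e e e = f)
include hΦ hpos hle he hmax

theorem d3_conditions_of_maximizer {v : E} (hv : d2 Φ x e v = 0) :
    d3 Φ x e e v = 0 ∧ d3 Φ x e v v ≤ f / 2 * d2 Φ x v v := by
  have hnonneg := apply_self_nonneg_of_pos (B := (d2 Φ x).toBilinForm) hpos v
  refine coeff_conditions_of_cubic_le (c := d3 Φ x v v v) hnonneg fun t => ?_
  have hmetric : d2 Φ x (e + t • v) (e + t • v) = 1 + d2 Φ x v v * t ^ 2 := by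
    simp only [map_add, map_smul, add_apply, smul_apply, smul_eq_mul, d2_comm hΦ x v e, he, hv]
    ring
  refine le_of_eq_of_le ?_ (hmetric ▸ hle (e + t • v))
  simp only [map_add, map_smul, add_apply, smul_apply, smul_eq_mul, d3_comm_left hΦ x v e,
    d3_comm_right hΦ x e v e, d3_comm_right hΦ x v v e, hmax]
  ring

theorem d3_maximizer_maximizer (w : E) : d3 Φ x e e w = f * d2 Φ x e w := by
  have hperp : d2 Φ x e (w - d2 Φ x e w • e) = 0 := by simp [he]
  have hzero := (d3_conditions_of_maximizer hΦ hpos hle he hmax hperp).1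
  rw [map_sub, map_smul, hmax, smul_eq_mul] at hzero
  linear_combination hzero

variable {A : E →L[ℝ] E} (hA : ∀ v w, d2 Φ x (A v) w = d2 (dirDeriv e Φ) x v w)
include hA

theorem map_maximizer : A e = f • e := by
  have hperp (w : E) : d2 Φ x (A e - f • e) w = 0 := by
    rw [map_sub, map_smul, sub_apply, hA, d2_dirDeriv hΦ,
      d3_maximizer_maximizer hΦ hpos hle he hmax, smul_apply, smul_eq_mul, sub_self]
  by_contra! hne
  exact (hpos _ (sub_ne_zero.2 hne)).ne' (hperp _)

theorem d2_maximizer_map {v : E} (hv : d2 Φ x e v = 0) : d2 Φ x e (A v) = 0 := by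
  rw [d2_comm hΦ, hA, d2_comm (contDiff_dirDeriv hΦ e), ← hA,
    map_maximizer hΦ hpos hle he hmax hA, map_smul, smul_apply, hv, smul_zero]

theorem le_sum_of_maximizer {ι : Type*} [Fintype ι] [DecidableEq ι] {b : Module.Basis ι ℝ E}
    (hb : hessianIn b Φ x = 1) {i₀ : ι} (hi₀ : b i₀ = e) (hf : 0 ≤ f) :
    1 / 4 * f ^ 3
      ≤ ∑ k, (3 / 4 * f * d2 Φ x (A (b k)) (A (b k)) - 1 / 2 * d3 Φ x e (A (b k)) (A (b k))) := by
  have hAe := map_maximizer hΦ hpos hle he hmax hA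
  have hterm_i₀ : 1 / 4 * f ^ 3
      = 3 / 4 * f * d2 Φ x (A (b i₀)) (A (b i₀)) - 1 / 2 * d3 Φ x e (A (b i₀)) (A (b i₀)) := by
    rw [hi₀, hAe]
    simp only [map_smul, smul_apply, smul_eq_mul, he, hmax]
    ring
  rw [hterm_i₀]
  refine Finset.single_le_sum (f := fun k => 3 / 4 * f * d2 Φ x (A (b k)) (A (b k))
    - 1 / 2 * d3 Φ x e (A (b k)) (A (b k))) (fun k _ => ?_) (Finset.mem_univ i₀)
  rcases eq_or_ne k i₀ with rfl | hk
  · rw [← hterm_i₀]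
    positivity
  have hperp : d2 Φ x e (b k) = 0 := by
    have hentry := congrFun (congrFun hb i₀) k
    rwa [hessianIn, LinearMap.BilinForm.toMatrix_apply, hi₀, Matrix.one_apply_ne hk.symm] at hentry
  have hcubic := (d3_conditions_of_maximizer hΦ hpos hle he hmax
    (d2_maximizer_map hΦ hpos hle he hmax hA hperp)).2
  have hnonneg := mul_nonneg hf
    (apply_self_nonneg_of_pos (B := (d2 Φ x).toBilinForm) hpos (A (b k)))
  simp only [ContinuousLinearMap.toBilinForm_apply] at hnonneg
  linarith

end Maximizer

section Maximum

theorem mul_tangent_le_of_le_sqrt_pow {f p q : ℝ} (hf : 0 ≤ f) (hq : 0 ≤ q) (hq5 : 3 * q ≤ 5)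
    (hp : p ≤ f * √q ^ 3) : p * ((5 - 3 * q) / 2) ≤ f := by
  obtain ⟨s, hs, rfl⟩ : ∃ s, 0 ≤ s ∧ q = s ^ 2 := ⟨√q, Real.sqrt_nonneg q, (Real.sq_sqrt hq).symm⟩
  rw [Real.sqrt_sq hs] at hp
  have htangent : 0 ≤ f * ((s - 1) ^ 2 * (3 * s ^ 3 + 6 * s ^ 2 + 4 * s + 2)) := by positivity
  linear_combination (5 - 3 * s ^ 2) / 2 * hp + htangent / 2

set_option maxSynthPendingDepth 3

/-- The normalized third derivative `Φ_{eee} / Φ_{ee}^{3/2}`, homogeneous of degree zero in `e`. -/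
noncomputable def normalizedThird {E : Type*} [NormedAddCommGroup E] [NormedSpace ℝ E]
    (Φ : E → ℝ) (x e : E) : ℝ :=
  d3 Φ x e e e / √(d2 Φ x e e) ^ 3

theorem normalizedThird_smul {E : Type*} [NormedAddCommGroup E] [NormedSpace ℝ E]
    (Φ : E → ℝ) (x e : E) {c : ℝ} (hc : 0 < c) :
    normalizedThird Φ x (c • e) = normalizedThird Φ x e := by
  have hsqrt : √(d2 Φ x (c • e) (c • e)) = c * √(d2 Φ x e e) := by
    simp only [map_smul, smul_apply, smul_eq_mul]
    rw [← mul_assoc, Real.sqrt_mul (mul_self_nonneg c), Real.sqrt_mul_self hc.le]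
  rw [normalizedThird, hsqrt]
  simp only [map_smul, smul_apply, smul_eq_mul, mul_pow]
  rw [← mul_assoc, ← mul_assoc, ← pow_three', mul_div_mul_left _ _ (pow_pos hc 3).ne',
    normalizedThird]

variable {n : ℕ} {Φ : EuclideanSpace ℝ (Fin n) → ℝ}

theorem mem_unitVectors {x e : EuclideanSpace ℝ (Fin n)} :
    e ∈ unitVectors Φ x ↔ d2 Φ x e e = 1 := by
  rw [unitVectors, Set.mem_ofPred_eq, iteratedFDeriv_two_eq_d2]

theorem mem_thirdDerivValues {x : EuclideanSpace ℝ (Fin n)} {r : ℝ} :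
    r ∈ thirdDerivValues Φ x ↔ ∃ e, d2 Φ x e e = 1 ∧ d3 Φ x e e e = r := by
  simp only [thirdDerivValues, Set.mem_image, mem_unitVectors, iteratedFDeriv_three_eq_d3]

theorem normalizedThird_mem_thirdDerivValues {x e : EuclideanSpace ℝ (Fin n)}
    (he : 0 < d2 Φ x e e) : normalizedThird Φ x e ∈ thirdDerivValues Φ x := by
  have hs : 0 < (√(d2 Φ x e e))⁻¹ := inv_pos.2 (Real.sqrt_pos.2 he)
  have hunit : d2 Φ x ((√(d2 Φ x e e))⁻¹ • e) ((√(d2 Φ x e e))⁻¹ • e) = 1 := by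
    simp only [map_smul, smul_apply, smul_eq_mul]
    rw [← mul_assoc, ← mul_inv, Real.mul_self_sqrt he.le, inv_mul_cancel₀ he.ne']
  refine mem_thirdDerivValues.2 ⟨_, hunit, ?_⟩
  rw [← normalizedThird_smul Φ x e hs, normalizedThird, hunit, Real.sqrt_one, one_pow, div_one]

theorem hessianMatrix_eq_hessianIn (u : EuclideanSpace ℝ (Fin n) → ℝ)
    (x : EuclideanSpace ℝ (Fin n)) :
    hessianMatrix u x = hessianIn (EuclideanSpace.basisFun (Fin n) ℝ).toBasis u x := by
  ext i j
  simp [hessianMatrix, hessianIn, LinearMap.BilinForm.toMatrix_apply, iteratedFDeriv_two_eq_d2]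

theorem weightedLaplacian_eq_sum_d2 {x : EuclideanSpace ℝ (Fin n)} (hΦ : ContDiff ℝ ∞ Φ)
    {b : Module.Basis (Fin n) ℝ (EuclideanSpace ℝ (Fin n))} (hb : hessianIn b Φ x = 1)
    (u : EuclideanSpace ℝ (Fin n) → ℝ) :
    weightedLaplacian Φ u x = ∑ k, d2 u x (b k) (b k) := by
  have hsymm : (hessianMatrix Φ x)⁻¹.IsSymm := by
    rw [Matrix.IsSymm, Matrix.transpose_nonsing_inv, hessianMatrix_eq_hessianIn]
    congr 1
    exact (LinearMap.BilinForm.isSymm_toMatrix_iff_isSymm _).2 ⟨d2_comm hΦ x⟩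
  calc weightedLaplacian Φ u x = ((hessianMatrix Φ x)⁻¹ * hessianMatrix u x).trace := by
        simp only [weightedLaplacian, Matrix.trace, Matrix.diag_apply, Matrix.mul_apply]
        rw [Finset.sum_comm]
        exact Finset.sum_congr rfl fun i _ => Finset.sum_congr rfl fun j _ => by
          rw [hsymm.apply]
    _ = ((hessianIn b Φ x)⁻¹ * hessianIn b u x).trace := by
        rw [hessianMatrix_eq_hessianIn, hessianMatrix_eq_hessianIn]
        exact trace_inv_toMatrix_mul_toMatrix _ _ _ _
    _ = ∑ k, d2 u x (b k) (b k) := by rw [hb, inv_one, one_mul, trace_hessianIn]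

namespace IsPotential

variable (hΦ : IsPotential Φ)
include hΦ

theorem det_hessianIn (b : Module.Basis (Fin n) ℝ (EuclideanSpace ℝ (Fin n)))
    (z : EuclideanSpace ℝ (Fin n)) :
    (hessianIn b Φ z).det
      = ((EuclideanSpace.basisFun (Fin n) ℝ).toBasis.toMatrix b).det ^ 2 * Real.exp (-Φ z) := by
  rw [hΦ.equation, hessianMatrix_eq_hessianIn, hessianIn, hessianIn,
    ← LinearMap.BilinForm.toMatrix_mul_basis_toMatrix
      (EuclideanSpace.basisFun (Fin n) ℝ).toBasis b,
    Matrix.det_mul, Matrix.det_mul, Matrix.det_transpose]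
  ring

theorem d2_pos (x v : EuclideanSpace ℝ (Fin n)) (hv : v ≠ 0) : 0 < d2 Φ x v v := by
  have hnonneg := d2_nonneg_of_convexOn hΦ.contDiff hΦ.convexOn x
  have hnondeg : (d2 Φ x).toBilinForm.Nondegenerate := by
    refine LinearMap.BilinForm.nondegenerate_of_det_ne_zero _
      (EuclideanSpace.basisFun (Fin n) ℝ).toBasis ?_
    rw [← hessianIn, ← hessianMatrix_eq_hessianIn, ← hΦ.equation]
    exact Real.exp_ne_zero _
  refine (hnonneg v).lt_of_ne' fun hzero => hv ?_
  exact ((LinearMap.BilinForm.nondegenerate_iff (d2 Φ x).toBilinForm hnonneg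
    ⟨d2_comm hΦ.contDiff x⟩).1 hnondeg v).1 hzero

theorem thirdDerivValues_eq_image (x : EuclideanSpace ℝ (Fin n)) :
    thirdDerivValues Φ x =
      (fun e : Metric.sphere (0 : EuclideanSpace ℝ (Fin n)) 1 => normalizedThird Φ x e) ''
        Set.univ := by
  ext r
  constructor
  · intro hr
    obtain ⟨e, he, rfl⟩ := mem_thirdDerivValues.1 hr
    have hne : e ≠ 0 := by
      rintro rfl
      simp at he
    refine ⟨⟨‖e‖⁻¹ • e, by simp [norm_smul, hne]⟩, Set.mem_univ _, ?_⟩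
    change normalizedThird Φ x (‖e‖⁻¹ • e) = _
    rw [normalizedThird_smul Φ x e (inv_pos.2 (norm_pos_iff.2 hne)), normalizedThird, he,
      Real.sqrt_one, one_pow, div_one]
  · rintro ⟨e, -, rfl⟩
    exact normalizedThird_mem_thirdDerivValues (hΦ.d2_pos x e (ne_zero_of_mem_unit_sphere e))

theorem continuous_normalizedThird :
    Continuous fun p : EuclideanSpace ℝ (Fin n) × Metric.sphere (0 : EuclideanSpace ℝ (Fin n)) 1 =>
      normalizedThird Φ p.1 p.2 := by
  have hd2 := (contDiff_d2 hΦ.contDiff).continuous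
  have hd3 := (contDiff_d3 hΦ.contDiff).continuous
  unfold normalizedThird
  refine Continuous.div (by fun_prop) (by fun_prop) fun p => ?_
  exact (pow_pos (Real.sqrt_pos.2 (hΦ.d2_pos p.1 p.2 (ne_zero_of_mem_unit_sphere p.2))) 3).ne'

theorem continuous_maxThirdDeriv : Continuous (maxThirdDeriv Φ) := by
  unfold maxThirdDeriv
  simp only [hΦ.thirdDerivValues_eq_image]
  exact isCompact_univ.continuous_sSup hΦ.continuous_normalizedThird

theorem isCompact_thirdDerivValues (x : EuclideanSpace ℝ (Fin n)) :
    IsCompact (thirdDerivValues Φ x) := by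
  rw [hΦ.thirdDerivValues_eq_image]
  exact isCompact_univ.image (hΦ.continuous_normalizedThird.comp (Continuous.prodMk_right x))

theorem isGreatest_maxThirdDeriv (hn : 1 ≤ n) (x : EuclideanSpace ℝ (Fin n)) :
    IsGreatest (thirdDerivValues Φ x) (maxThirdDeriv Φ x) := by
  have hne : EuclideanSpace.single (⟨0, hn⟩ : Fin n) (1 : ℝ) ≠ 0 := by simp
  exact (hΦ.isCompact_thirdDerivValues x).isGreatest_sSup
    ⟨_, normalizedThird_mem_thirdDerivValues (hΦ.d2_pos x _ hne)⟩

theorem d3_le_maxThirdDeriv (x v : EuclideanSpace ℝ (Fin n)) :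
    d3 Φ x v v v ≤ maxThirdDeriv Φ x * √(d2 Φ x v v) ^ 3 := by
  rcases eq_or_ne v 0 with rfl | hv
  · simp
  have hpos := hΦ.d2_pos x v hv
  exact (div_le_iff₀ (pow_pos (Real.sqrt_pos.2 hpos) 3)).1
    (le_csSup (hΦ.isCompact_thirdDerivValues x).bddAbove
      (normalizedThird_mem_thirdDerivValues hpos))

theorem maxThirdDeriv_nonneg (hn : 1 ≤ n) (x : EuclideanSpace ℝ (Fin n)) :
    0 ≤ maxThirdDeriv Φ x := by
  obtain ⟨e, he, hmax⟩ := mem_thirdDerivValues.1 (hΦ.isGreatest_maxThirdDeriv hn x).1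
  have hle := hΦ.d3_le_maxThirdDeriv x (-e)
  simp only [map_neg, neg_apply, neg_neg, he, hmax, Real.sqrt_one, one_pow, mul_one] at hle
  linarith

end IsPotential

end Maximum

section BarrierSense

set_option maxSynthPendingDepth 3

variable {n : ℕ} {Φ : EuclideanSpace ℝ (Fin n) → ℝ}
  {A : EuclideanSpace ℝ (Fin n) →L[ℝ] EuclideanSpace ℝ (Fin n)} {x e : EuclideanSpace ℝ (Fin n)}

namespace IsPotential

variable (hΦ : IsPotential Φ)
include hΦ

theorem barrier_le_maxThirdDeriv (hn : 1 ≤ n) {z : EuclideanSpace ℝ (Fin n)}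
    (hz : z ∈ barrierDomain Φ A x e) : barrier Φ A x e z ≤ maxThirdDeriv Φ z :=
  mul_tangent_le_of_le_sqrt_pow (hΦ.maxThirdDeriv_nonneg hn z)
    (d2_nonneg_of_convexOn hΦ.contDiff hΦ.convexOn z _) hz.le (hΦ.d3_le_maxThirdDeriv z _)

theorem exists_basis_hessianIn_eq_one (x : EuclideanSpace ℝ (Fin n)) (i₀ : Fin n)
    (he : d2 Φ x e e = 1) :
    ∃ b : Module.Basis (Fin n) ℝ (EuclideanSpace ℝ (Fin n)), b i₀ = e ∧ hessianIn b Φ x = 1 :=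
  exists_basis_toMatrix_eq_one (B := (d2 Φ x).toBilinForm) ⟨d2_comm hΦ.contDiff x⟩ (hΦ.d2_pos x)
    (by simp) i₀ he

theorem le_weightedLaplacian_barrier (hn : 1 ≤ n) (he : d2 Φ x e e = 1)
    (hmax : d3 Φ x e e e = maxThirdDeriv Φ x)
    (hA : ∀ v w, d2 Φ x (A v) w = d2 (dirDeriv e Φ) x v w) :
    1 / 2 * maxThirdDeriv Φ x + 1 / 4 * maxThirdDeriv Φ x ^ 3
      ≤ weightedLaplacian Φ (barrier Φ A x e) x := by
  obtain ⟨b, hbe, hb⟩ := hΦ.exists_basis_hessianIn_eq_one x ⟨0, hn⟩ he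
  have hdet_ne : ((EuclideanSpace.basisFun (Fin n) ℝ).toBasis.toMatrix b).det ≠ 0 :=
    (Matrix.isUnit_det_of_right_inverse (Module.Basis.toMatrix_mul_toMatrix_flip _ b)).ne_zero
  have hsum := le_sum_of_maximizer hΦ.contDiff (hΦ.d2_pos x) (hΦ.d3_le_maxThirdDeriv x) he hmax hA
    hb hbe (hΦ.maxThirdDeriv_nonneg hn x)
  rw [Finset.sum_sub_distrib, ← Finset.mul_sum, ← Finset.mul_sum] at hsum
  rw [weightedLaplacian_eq_sum_d2 hΦ.contDiff hb, sum_d2_barrier hΦ.contDiff hA he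
    (pow_ne_zero 2 hdet_ne) (hΦ.det_hessianIn b) hb, hmax]
  linear_combination hsum

theorem laplacianGeInBarrierSense (hn : 1 ≤ n) :
    LaplacianGeInBarrierSense Φ (maxThirdDeriv Φ)
      (fun x => 1 / 2 * maxThirdDeriv Φ x + 1 / 4 * maxThirdDeriv Φ x ^ 3) := by
  refine ⟨hΦ.continuous_maxThirdDeriv, fun x₀ => ?_⟩
  obtain ⟨e, he, hmax⟩ := mem_thirdDerivValues.1 (hΦ.isGreatest_maxThirdDeriv hn x₀).1
  obtain ⟨A, hA⟩ := exists_clm_apply_eq (hΦ.d2_pos x₀) (d2 (dirDeriv e Φ) x₀)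
  exact ⟨barrierDomain Φ A x₀ e, isOpen_barrierDomain hΦ.contDiff A x₀ e,
    mem_barrierDomain_self A he,
    barrier Φ A x₀ e, (contDiff_barrier hΦ.contDiff A x₀ e).contDiffOn,
    fun _ hz => hΦ.barrier_le_maxThirdDeriv hn hz, (barrier_self A he).trans hmax,
    hΦ.le_weightedLaplacian_barrier hn he hmax hA⟩

end IsPotential

end BarrierSense

end KahlerEinstein

theorem mainTheorem6 (n : ℕ) (hn : 1 ≤ n) (Φ : EuclideanSpace ℝ (Fin n) → ℝ)
    (hΦ : KahlerEinstein.IsPotential Φ) :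
    (∀ x, IsGreatest (KahlerEinstein.thirdDerivValues Φ x) (KahlerEinstein.maxThirdDeriv Φ x)) ∧
      KahlerEinstein.LaplacianGeInBarrierSense Φ (KahlerEinstein.maxThirdDeriv Φ)
        (fun x => (1 / 2) * KahlerEinstein.maxThirdDeriv Φ x
          + (1 / 4) * KahlerEinstein.maxThirdDeriv Φ x ^ 3) := by
  exact ⟨hΦ.isGreatest_maxThirdDeriv hn, hΦ.laplacianGeInBarrierSense hn⟩
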